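/- All graphs are finite and simple, and $N[x]$ denotes the closed neighbourhood of $x$. Let $G$ be a graph such that - $G$ is reduced, i.e. no two distinct vertices of $G$ have the same closed neighbourhood; - $G$ is a proper circular-arc graph, i.e. the intersection graph of a family of arcs of a circle none of which is properly contained in another; - $G$ is not a proper interval graph, i.e. not the intersection graph of a family of intervals of a line none of which is properly contained in another; - $cc(G)\ge 3$, where $cc(G)$ is the least number of cliques of $G$ that together cover all vertices of $G$. Let $v_1,v_2,\dots,v_n$ be a round ordering of $G$, i.e. a circular ordering of the vertices of $G$ such that for each $i$ there are integers $\ell,\gamma\ge 0$ (depending on $i$) with \[N[v_i]=\{v_{i-\ell},\dots,v_{i-1},v_i,v_{i+1},\dots,v_{i+\gamma}\},\] indices being taken modulo $n$. Call $v_i$ a pseudo-cutvertex if $v_{i-1}$ and $v_{i+1}$ are not adjacent. If $G$ has exactly one pseudo-cutvertex, then $G$ is not locally complete 2-edge-colourable, i.e. there is no colouring of the edges of $G$ with two colours (adjacent edges may have the same colour) such that for each vertex $x$ and each colour $c$ the vertices joined to $x$ by edges of colour $c$ form a clique. -/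

import Mathlib

namespace SimpleGraph

variable {V : Type*}

/-- The closed neighbourhood `N[x]`. -/
def closedNeighborSet (G : SimpleGraph V) (x : V) : Set V :=
  insert x (G.neighborSet x)

/-- A graph is reduced if it has no true twins, i.e. no two distinct vertices with the same
closed neighbourhood. -/
def IsReduced (G : SimpleGraph V) : Prop :=
  ∀ x y : V, G.closedNeighborSet x = G.closedNeighborSet y → x = y

/-- `G` is the intersection graph of the family of sets `S`, indexed by the vertices. -/
def IsIntersectionGraphOf {X : Type*} (G : SimpleGraph V) (S : V → Set X) : Prop :=
  ∀ x y : V, G.Adj x y ↔ x ≠ y ∧ (S x ∩ S y).Nonempty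

/-- Proper interval graphs: intersection graphs of (nonempty, closed) intervals of the real line,
none of which is properly contained in another. -/
def IsProperInterval (G : SimpleGraph V) : Prop :=
  ∃ a b : V → ℝ, (∀ x, a x ≤ b x) ∧
    (∀ x y, ¬ Set.Icc (a x) (b x) ⊂ Set.Icc (a y) (b y)) ∧
    G.IsIntersectionGraphOf fun x => Set.Icc (a x) (b x)

/-- The (closed) arc of the circle `ℝ / ℤ` that runs from `a` to `b` in the positive direction. -/
def circularArc (a b : ℝ) : Set (AddCircle (1 : ℝ)) :=
  (fun t : ℝ => (t : AddCircle (1 : ℝ))) '' Set.Icc a b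

/-- Proper circular-arc graphs: intersection graphs of (nonempty, closed) arcs of a circle,
none of which is properly contained in another. -/
def IsProperCircularArc (G : SimpleGraph V) : Prop :=
  ∃ a b : V → ℝ, (∀ x, a x ≤ b x) ∧
    (∀ x y, ¬ circularArc (a x) (b x) ⊂ circularArc (a y) (b y)) ∧
    G.IsIntersectionGraphOf fun x => circularArc (a x) (b x)

/-- The clique covering number `cc(G)`: the least number of cliques that together cover all
vertices. -/
noncomputable def cliqueCoveringNumber (G : SimpleGraph V) : ℕ :=
  sInf {k : ℕ | ∃ K : Fin k → Set V, (∀ i, G.IsClique (K i)) ∧ ∀ x, ∃ i, x ∈ K i}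

/-- A circular ordering `v` of the vertices, with indices modulo `n`, is a round ordering of `G`
if for each `i` there are `ℓ, γ ≥ 0` (depending on `i`) with
`N[v i] = {v (i - ℓ), …, v (i - 1), v i, v (i + 1), …, v (i + γ)}`. -/
def IsRoundOrdering (G : SimpleGraph V) {n : ℕ} (v : ZMod n ≃ V) : Prop :=
  ∀ i : ZMod n, ∃ l r : ℕ,
    G.closedNeighborSet (v i) =
      {x | ∃ k : ℤ, -(l : ℤ) ≤ k ∧ k ≤ (r : ℤ) ∧ x = v (i + (k : ZMod n))}

/-- A vertex is a pseudo-cutvertex (with respect to a circular ordering `v`) if its predecessor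
and its successor in the ordering are not adjacent. -/
def IsPseudoCutvertex (G : SimpleGraph V) {n : ℕ} (v : ZMod n ≃ V) (x : V) : Prop :=
  ¬ G.Adj (v (v.symm x - 1)) (v (v.symm x + 1))

/-- A 2-edge-colouring is locally complete if for each vertex `x` and each colour `c`, the vertices
joined to `x` by edges of colour `c` induce a complete subgraph. The colouring need not be proper.-/
def IsLocallyCompleteColouring (G : SimpleGraph V) (φ : G.EdgeLabeling (Fin 2)) : Prop :=
  ∀ (x : V) (c : Fin 2), G.IsClique {y | ∃ h : G.Adj x y, φ.get x y h = c}

/-- `G` has a locally complete 2-edge-colouring. -/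
def IsLocallyCompleteTwoEdgeColourable (G : SimpleGraph V) : Prop :=
  ∃ φ : G.EdgeLabeling (Fin 2), G.IsLocallyCompleteColouring φ

end SimpleGraph

/-! Cut the circle at the pseudo-cutvertex p, whose two copies become 0 and n. As cc(G) ≥ 3,
adjacency is described by a monotone reach R with left adjoint L. The absence of other
pseudo-cutvertices gives R x ≥ x + 2, and reducedness forbids inner neighbours x, x + 1 with equal R
and equal L. A locally complete colouring gives different colours to the two edges of every induced
three-vertex path.

Hence the edges at p have one colour on one side and the other colour on the other side. If R (R (R
0)) ≥ n, seven induced paths form an odd cycle of constraints. Otherwise colour each j by the edge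
from L j: colours alternate along adjacent non-nested pairs, which `not_isAlternating` refutes.
There the greedy chains 0, R 0, R² 0, … and n, L n, L² n, … interlace, and alternation makes the
number of jumps from 0 to n even. Pair the points of the two chains: reducedness and alternation
make the partners reach equally far exactly at even indices, yet they do so at the last index, which
is odd. -/

/-- The combinatorial data of a round ordering cut open at its pseudo-cutvertex: the vertices are
`0, …, n`, the vertex `i` is joined to `i + 1, …, R i` on its right, and `L j` is the leftmost
neighbour of `j`. -/
structure CutOrder (n : ℕ) (R L : ℕ → ℕ) : Prop where
  mono : Monotone R
  gc : GaloisConnection L R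
  le_last : ∀ x ≤ n, R x ≤ n
  add_two_le : ∀ x, x + 2 ≤ n → x + 2 ≤ R x
  le_right : ∀ x, x ≤ R x
  lt_right : ∀ x < n, x < R x
  not_twin : ∀ x, 0 < x → x + 1 < n → R x < R (x + 1) ∨ L x < L (x + 1)

/-! ### Greedy chains and alternating vertex colourings -/

namespace CutOrder

variable {n : ℕ} {R L : ℕ → ℕ}

theorem left_lt (h : CutOrder n R L) {x : ℕ} (h0 : 0 < x) (hx : x ≤ n) : L x < x := by
  have h1 := h.lt_right (x - 1) (by omega)
  have h2 : L x ≤ x - 1 := h.gc.l_le (by omega)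
  omega

theorem left_lt_iff (h : CutOrder n R L) {x i : ℕ} : i < L x ↔ R i < x := by
  rw [← not_le, ← not_le, h.gc x i]

theorem le_right_left (h : CutOrder n R L) (x : ℕ) : x ≤ R (L x) := h.gc.le_u_l x

theorem left_right_le (h : CutOrder n R L) (x : ℕ) : L (R x) ≤ x := h.gc.l_u_le x

theorem iterate_gc (h : CutOrder n R L) (m : ℕ) (x i : ℕ) : L^[m] x ≤ i ↔ x ≤ R^[m] i := by
  induction m generalizing x i with
  | zero => simp
  | succ m ih => rw [Function.iterate_succ_apply, ih, Function.iterate_succ_apply', h.gc]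

theorem lt_iterate_left (h : CutOrder n R L) (m : ℕ) (x i : ℕ) : i < L^[m] x ↔ R^[m] i < x := by
  rw [← not_le, ← not_le, h.iterate_gc]

/-- A vertex colouring of a cut order that alternates along the non-nested adjacent pairs. -/
structure IsAlternating (n : ℕ) (R L : ℕ → ℕ) (c : ℕ → Bool) : Prop where
  ne : ∀ i j, 0 < i → i < j → j < n → j ≤ R i → R i < R j → L i < L j → c i ≠ c j
  ne_first : ∀ j, 0 < j → j ≤ R 0 → c j ≠ c n
  ne_last : ∀ i, 0 < i → i < n → n ≤ R i → L i < L n → c i ≠ c n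

variable {c : ℕ → Bool}

/-- The condition R (L x) < R x makes x and R x a non-nested pair, and it persists along x, R x, R²
x, …. So colours flip at each jump until the last vertex before n, which differs from n. -/
theorem colour_eq_of_right (h : CutOrder n R L) (hc : IsAlternating n R L c) (m : ℕ) :
    ∀ x, 0 < x → R (L x) < R x → R^[m] x < n → n ≤ R^[m + 1] x →
      c x = xor (c n) (m + 1).bodd := by
  induction m with
  | zero =>
    intro x hx hns h1 h2
    simp only [Function.iterate_zero, id_eq, zero_add, Function.iterate_one] at h1 h2
    have h3 := h.le_last x h1.le
    have := hc.ne_last x hx h1 h2 (h.left_lt_iff.2 (by omega))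
    revert this
    cases c x <;> cases c n <;> simp
  | succ m ih =>
    intro x hx hns h1 h2
    have hle : ∀ m y, y ≤ R^[m] y := fun m => Function.id_le_iterate_of_id_le h.le_right m
    have hlt : R x < n := by
      rw [Function.iterate_succ_apply] at h1
      exact (hle m (R x)).trans_lt h1
    have hxn : x < n := (h.le_right x).trans_lt hlt
    have hx1 := h.lt_right x hxn
    have hx2 := h.lt_right (R x) hlt
    have h5 := ih (R x) (by omega) ((h.mono (h.left_right_le x)).trans_lt hx2)
      (by simpa only [Function.iterate_succ_apply] using h1)
      (by simpa only [Function.iterate_succ_apply] using h2)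
    have h6 := hc.ne x (R x) hx hx1 hlt le_rfl hx2 (h.left_lt_iff.2 hns)
    rw [Nat.bodd_succ]
    revert h5 h6
    cases c x <;> cases c n <;> cases c (R x) <;> cases (m + 1).bodd <;> simp

/-- Mirror image, with jumps x ↦ L x; the chain ends at a neighbour of 0, whose colour differs from
c n. -/
theorem colour_eq_of_left (h : CutOrder n R L) (hc : IsAlternating n R L c) (m : ℕ) :
    ∀ x, x < n → R (L x) < R x → 0 < L^[m] x → L^[m + 1] x = 0 →
      c x = xor (c n) (m + 1).bodd := by
  induction m with
  | zero =>
    intro x hx hns h1 h2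
    simp only [Function.iterate_zero, id_eq, zero_add, Function.iterate_one] at h1 h2
    have := hc.ne_first x h1 ((h.gc x 0).1 h2.le)
    revert this
    cases c x <;> cases c n <;> simp
  | succ m ih =>
    intro x hx hns h1 h2
    have hpos : 0 < L x := by
      rw [h.lt_iterate_left] at h1
      rw [h.left_lt_iff]
      refine lt_of_le_of_lt ?_ h1
      rw [Function.iterate_succ_apply']
      exact h.mono (Nat.zero_le _)
    have hx0 : 0 < x := by
      rw [h.left_lt_iff] at hpos
      omega
    have hl1 := h.left_lt hx0 hx.le
    have hl2 := h.left_lt hpos (by omega)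
    have hr : R (L (L x)) < x := h.left_lt_iff.1 hl2
    have hr2 := h.le_right_left x
    have h5 := ih (L x) (by omega) (by omega)
      (by simpa only [Function.iterate_succ_apply] using h1)
      (by simpa only [Function.iterate_succ_apply] using h2)
    have h6 := hc.ne (L x) x hpos hl1 hx hr2 hns hl2
    rw [Nat.bodd_succ]
    revert h5 h6
    cases c x <;> cases c n <;> cases c (L x) <;> cases (m + 1).bodd <;> simp

/-- The two greedy chains, from the left end and from the right end, cannot always be linked by
alternating colours. -/
theorem not_isAlternating (h : CutOrder n R L) (h0 : R 0 < n) : ¬ IsAlternating n R L c := by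
  intro hc
  have hstep : ∀ m, R^[m] 0 < n → R^[m] 0 < R^[m + 1] 0 := fun m hm => by
    rw [Function.iterate_succ_apply']
    exact h.lt_right _ hm
  have hex : ∃ m, n ≤ R^[m] 0 := by
    by_contra hcon
    push Not at hcon
    have : ∀ m, m ≤ R^[m] 0 := by
      intro m
      induction m with
      | zero => simp
      | succ m ih => have := hstep m (hcon m); omega
    have h1 := this n
    have h2 := hcon n
    omega
  obtain ⟨d, hd, hmin⟩ : ∃ d, n ≤ R^[d] 0 ∧ ∀ m < d, R^[m] 0 < n :=
    ⟨Nat.find hex, Nat.find_spec hex, fun m hm => not_le.1 (Nat.find_min hex hm)⟩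
  have hd2 : 2 ≤ d := by
    by_contra hlt
    interval_cases d
    · simp at hd; omega
    · simp at hd; omega
  obtain ⟨e, rfl⟩ := Nat.exists_eq_add_of_le' hd2
  have hR0 : 0 < R 0 := h.lt_right 0 (by omega)
  have hns : ∀ y, R y < n → R (L (R y)) < R (R y) := fun y hy =>
    (h.mono (h.left_right_le y)).trans_lt (h.lt_right _ hy)
  -- the length of the greedy chain is even
  have hodd : (e + 1).bodd = true := by
    have h1 := h.colour_eq_of_right hc e (R 0) hR0 (hns 0 h0)
      (by rw [← Function.iterate_succ_apply]; exact hmin _ (by omega))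
      (by rw [← Function.iterate_succ_apply]; exact hd)
    have h2 := hc.ne_first (R 0) hR0 le_rfl
    revert h1 h2
    cases c (R 0) <;> cases c n <;> cases (e + 1).bodd <;> simp
  -- the position of the chains relative to each other
  have hlow : ∀ k j, k + j < e + 2 → R^[k] 0 < L^[j] n := fun k j hkj => by
    rw [h.lt_iterate_left, ← Function.iterate_add_apply]
    exact hmin _ (by omega)
  have hhigh : ∀ k j, k + j = e + 2 → L^[j] n ≤ R^[k] 0 := fun k j hkj => by
    rw [h.iterate_gc, ← Function.iterate_add_apply, add_comm, hkj]
    exact hd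
  -- For k > 0, both `L^[i + 1] n` and `R^[k] 0` lie in the interval from `R^[k - 1] 0` (excluded)
  -- to `R^[k] 0`. The induction shows that agreement of their reaches flips with k.
  have key : ∀ k i, k + i = e + 1 →
      (R (L^[i + 1] n) = R (R^[k] 0) ↔ k.bodd = false) := by
    intro k
    induction k with
    | zero =>
      intro i hi
      have := hhigh 0 (i + 1) (by omega)
      simp only [Function.iterate_zero, id_eq, Nat.le_zero] at this
      simp [this]
    | succ k ih =>
      intro i hi
      have hP := ih (i + 1) (by omega)
      rw [Nat.bodd_succ, Bool.not_eq_eq_eq_not, Bool.not_false]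
      set w := L^[i + 1] n with hw
      have hz : L^[i + 1 + 1] n = L w := by rw [hw, Function.iterate_succ_apply']
      have hr : R^[k + 1] 0 = R (R^[k] 0) := Function.iterate_succ_apply' _ _ _
      rw [hz] at hP
      have hlow1 : R^[k] 0 < w := hlow k (i + 1) (by omega)
      have hlow2 : R^[k + 1] 0 < L^[i] n := hlow (k + 1) i (by omega)
      have hhigh1 : w ≤ R^[k + 1] 0 := hhigh (k + 1) (i + 1) (by omega)
      have hhigh2 : L w ≤ R^[k] 0 := by rw [← hz]; exact hhigh k (i + 2) (by omega)
      have hrn : R^[k + 1] 0 < n := hmin _ (by omega)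
      have hwn : L^[i] n ≤ R w := by
        rw [hw, Function.iterate_succ_apply']
        exact h.le_right_left _
      set r := R^[k] 0 with hrdef
      rw [hr] at hlow2 hhigh1 hrn ⊢
      constructor
      · intro heq
        by_contra hk
        have hP' : R (L w) = R r := hP.2 (by simpa using hk)
        rcases hhigh1.lt_or_eq with hlt | hweq
        -- Here w and w + 1 would be twins: both reach R (R r), and w + 1 ≤ R r = R (L w) equates
        -- their left ends.
        · rcases h.not_twin w (by omega) (by omega) with h1 | h1
          · have := h.mono (show w + 1 ≤ R r by omega)
            omega
          · rw [h.left_lt_iff] at h1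
            omega
        -- Now w = R r lies on both chains. Its predecessor is i + 2 flips from the right end and k
        -- + 1 from the left; these parities differ because e + 1 is odd.
        · have h2 := h.add_two_le (w - 1) (by omega)
          have hL : L (w - 1) ≤ L w := h.gc.monotone_l (by omega)
          have hmono := h.mono hL
          have hnsw : R (L (w - 1)) < R (w - 1) := by omega
          have hne : r ≠ w - 1 := by rintro h3; rw [← h3] at h2; omega
          have c1 := h.colour_eq_of_right hc (i + 1) (w - 1) (by omega) hnsw
            (by rw [← h.lt_iterate_left]; omega)
            (by rw [← h.iterate_gc, hz]; omega)
          have c2 := h.colour_eq_of_left hc k (w - 1) (by omega) hnsw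
            (by rw [h.lt_iterate_left]; omega)
            (by rw [← Nat.le_zero, h.iterate_gc, hr]; omega)
          have hpar : (k + (i + 1) + 1).bodd = (e + 1 + 1).bodd := by rw [← hi]; congr 1; omega
          simp only [Nat.bodd_succ, Nat.bodd_add] at hpar c1 c2 hodd
          rw [c1] at c2
          revert hpar c2 hodd
          cases c n <;> cases k.bodd <;> cases i.bodd <;> cases e.bodd <;> simp
      · intro hk
        have hP' : R (L w) ≠ R r := fun h1 => by rw [hP.1 h1] at hk; simp at hk
        have hlt : R (L w) < R r := lt_of_le_of_ne (h.mono hhigh2) hP'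
        -- Both w and R r are i + 1 greedy jumps from n, so they share a colour; but they would be
        -- an adjacent non-nested pair.
        by_contra hne
        have hwr : w < R r := lt_of_le_of_lt (h.le_right_left w) hlt
        refine hc.ne w (R r) (by omega) hwr hrn (by omega)
          (lt_of_le_of_ne (h.mono hhigh1) hne) (h.left_lt_iff.2 hlt) ?_
        rw [h.colour_eq_of_right hc i w (by omega)
            (lt_of_lt_of_le hlt (by omega))
            (by rw [← h.lt_iterate_left]; omega) (by rw [← h.iterate_gc]),
          h.colour_eq_of_right hc i (R r) (by omega) (hns r hrn)
            (by rw [← h.lt_iterate_left]; omega)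
            (by rw [← h.iterate_gc]; omega)]
  -- L n and `R^[e + 1] 0` both reach exactly n, so the invariant would make e + 1 even.
  have hlast := (key (e + 1) 0 (by omega)).1 (by
    have h1 : ∀ x, x ≤ n → n ≤ R x → R x = n := fun x hx hx' => le_antisymm (h.le_last x hx) hx'
    rw [h1 (L^[0 + 1] n), h1 (R^[e + 1] 0)]
    · exact (hmin _ (by omega)).le
    · rw [← Function.iterate_succ_apply' R]; exact hd
    · exact (h.left_lt (by omega) le_rfl).le
    · exact h.le_right_left n)
  rw [hodd] at hlast
  exact absurd hlast (by simp)

end CutOrder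

/-! ### Edge colourings of a cut order -/

namespace CutOrder

variable {n : ℕ} {R L : ℕ → ℕ}

/-- A colouring of the edges of a cut order, whose ends `0` and `n` stand for the same vertex, in
which the edges of each induced path with three vertices have different colours. -/
structure IsLocallyComplete (n : ℕ) (R : ℕ → ℕ) (F : ℕ → ℕ → Bool) : Prop where
  ne : ∀ i j k, i < j → j < k → k ≤ n → j ≤ R i → k ≤ R j → R i < k →
    ¬ (i = 0 ∧ n ≤ R k) → ¬ (k = n ∧ i ≤ R 0) → F i j ≠ F j k
  ne_end : ∀ i k, i < n → n ≤ R i → 0 < k → k ≤ R 0 → ¬ i ≤ R k → F i n ≠ F 0 k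

variable {F : ℕ → ℕ → Bool}

/-- For a non-nested pair i < j, the induced paths (L i, i, j), (i, j, R j), (L j, j, R j) give
three flips. The bound `h3` keeps such paths from closing up through p. -/
theorem isAlternating_of_isLocallyComplete (h : CutOrder n R L) (hF : IsLocallyComplete n R F)
    (h3 : R (R (R 0)) < n) (hend : ∀ i k, i < n → n ≤ R i → 0 < k → k ≤ R 0 → F i n ≠ F 0 k) :
    IsAlternating n R L fun j => F (L j) j := by
  have h01 := h.le_right (R 0)
  have h12 := h.le_right (R (R 0))
  have hR0 : 0 < R 0 := h.lt_right 0 (by omega)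
  have hLn : L n < n := h.left_lt (by omega) le_rfl
  have hne : ∀ i j k, i < j → j < k → k ≤ n → j ≤ R i → k ≤ R j → R i < k → F i j ≠ F j k := by
    intro i j k hij hjk hk hj hk' hik
    refine hF.ne i j k hij hjk hk hj hk' hik ?_ ?_
    · rintro ⟨rfl, hcon⟩
      have := h.mono (hk'.trans (h.mono hj))
      omega
    · rintro ⟨rfl, hcon⟩
      have := h.mono (hj.trans (h.mono hcon))
      omega
  have hleft : ∀ i j, 0 < i → i < j → j ≤ n → j ≤ R i → L i < L j → F (L i) i ≠ F i j := by
    intro i j hi hij hj hji hL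
    exact hne _ _ _ (h.left_lt hi (by omega)) hij hj (h.le_right_left i) hji (h.left_lt_iff.1 hL)
  refine ⟨fun i j hi hij hj hji hR hL => ?_, fun j hj hjR => ?_, fun i hi hin hR hL => ?_⟩
  · have h1 := hleft i j hi hij hj.le hji hL
    have hRj := h.lt_right j hj
    have hRn := h.le_last j hj.le
    have h2 := hne i j (R j) hij hRj hRn hji le_rfl hR
    have hLj : L j ≤ i := (h.gc j i).2 hji
    have h4 := hne (L j) j (R j) (h.left_lt (by omega) hj.le) hRj hRn (h.le_right_left j) le_rfl
      ((h.mono hLj).trans_lt hR)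
    revert h1 h2 h4
    cases F (L i) i <;> cases F i j <;> cases F j (R j) <;> cases F (L j) j <;> simp
  · have hL : L j = 0 := Nat.le_zero.1 ((h.gc j 0).2 hjR)
    simp only [hL]
    exact (hend (L n) j hLn (h.le_right_left n) hj hjR).symm
  · have h1 := hleft i n hi hin le_rfl hR hL
    have h2 := hend i 1 hin hR one_pos hR0
    have h4 := hend (L n) 1 hLn (h.le_right_left n) one_pos hR0
    revert h1 h2 h4
    cases F (L i) i <;> cases F i n <;> cases F (L n) n <;> cases F 0 1 <;> simp

/-- `h0` and `h1` record that two consecutive greedy cliques, started at 0 or at 1, do not cover the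
circle. -/
theorem not_isLocallyComplete (h : CutOrder n R L) (h0 : R (R 0 + 1) + 1 < n)
    (h1 : R (R 1 + 1) < n) : ¬ IsLocallyComplete n R F := by
  intro hF
  have hR01 : R 0 ≤ R 1 := h.mono zero_le_one
  have hR02 : 2 ≤ R 0 := by
    have := h.le_right (R 0 + 1)
    exact h.add_two_le 0 (by omega)
  have hR2 : R (R 0) ≤ R (R 0 + 1) := h.mono (by omega)
  have hge0 := h.le_right (R 0)
  have hend1 : ∀ i, i < n → n ≤ R i → F i n ≠ F 0 1 := by
    intro i hi hin
    refine hF.ne_end i 1 hi hin one_pos (by omega) fun hle => ?_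
    have := h.mono (show i ≤ R 1 + 1 by omega)
    omega
  have hlast : n ≤ R (n - 1) := by
    have := h.lt_right (n - 1) (by omega)
    omega
  -- The vertices 1 and n - 1 serve as references: neither has a neighbour among the neighbours of p
  -- on the opposite side.
  have hend : ∀ i k, i < n → n ≤ R i → 0 < k → k ≤ R 0 → F i n ≠ F 0 k := by
    intro i k hi hin hk hkR
    have e1 := hend1 i hi hin
    have e2 := hend1 (n - 1) (by omega) hlast
    have e3 := hF.ne_end (n - 1) k (by omega) hlast hk hkR fun hle => by
      have := h.mono hkR
      omega
    revert e1 e2 e3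
    cases F i n <;> cases F 0 1 <;> cases F (n - 1) n <;> cases F 0 k <;> simp
  by_cases h3 : R (R (R 0)) < n
  · exact h.not_isAlternating (by omega) (h.isAlternating_of_isLocallyComplete hF h3 hend)
  -- otherwise `0`, `R 0`, `R (R 0)` form a triangle
  set r := R 0 with hr
  set s := R r with hs
  have hz : L n ≤ s := (h.gc n s).2 (by omega)
  have hz1 : R 1 + 1 < L n := h.left_lt_iff.2 h1
  have hz2 : r + 1 < L n := h.left_lt_iff.2 (by omega)
  have hz3 : R (L n - 1) < n := by
    rw [← h.left_lt_iff]; omega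
  -- The vertex r + 1 is the first beyond the reach of 0, and L n - 1 the last not reaching n. The
  -- seven inequalities form a 7-cycle on seven edges, which two colours cannot satisfy.
  have a1 := hF.ne (r + 1) s n (by omega) (by omega) le_rfl (by omega) (by omega) (by omega)
    (by omega) (by omega)
  have a2 := hF.ne (r + 1) s (n - 1) (by omega) (by omega) (by omega) (by omega) (by omega)
    (by omega) (by omega) (by omega)
  have a3 := hF.ne r s (n - 1) (by omega) (by omega) (by omega) (by omega) (by omega)
    (by omega) (by omega) (by omega)
  have a4 := hF.ne 0 r (L n - 1) (by omega) (by omega) (by omega) (by omega) (by omega)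
    (by omega) (by omega) (by omega)
  have a5 := hF.ne 1 r (L n - 1) (by omega) (by omega) (by omega) (by omega) (by omega)
    (by omega) (by omega) (by omega)
  have a6 := hF.ne 1 r s (by omega) (by omega) (by omega) (by omega) (by omega)
    (by omega) (by omega) (by omega)
  have a7 := hend s r (by omega) (by omega) (by omega) le_rfl
  revert a1 a2 a3 a4 a5 a6 a7
  cases F (r + 1) s <;> cases F s n <;> cases F s (n - 1) <;> cases F r s <;> cases F 0 r <;>
    cases F 1 r <;> cases F r (L n - 1) <;> simp

end CutOrder
-- Round orderings with clique covering number at least three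
namespace SimpleGraph
variable {V : Type*}

variable {G : SimpleGraph V} {n : ℕ} {v : ZMod n ≃ V}

theorem mem_closedNeighborSet {x y : V} : y ∈ G.closedNeighborSet x ↔ y = x ∨ G.Adj x y := by
  simp [closedNeighborSet]

theorem mem_closedNeighborSet_comm {x y : V} :
    y ∈ G.closedNeighborSet x ↔ x ∈ G.closedNeighborSet y := by
  rw [mem_closedNeighborSet, mem_closedNeighborSet, eq_comm, G.adj_comm]

theorem not_cover_of_three_le (hcc : 3 ≤ G.cliqueCoveringNumber) {A B : Set V}
    (hA : G.IsClique A) (hB : G.IsClique B) : ¬ ∀ x, x ∈ A ∨ x ∈ B := by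
  intro h
  have : G.cliqueCoveringNumber ≤ 2 := by
    refine Nat.sInf_le ⟨![A, B], fun i => ?_, fun x => ?_⟩
    · fin_cases i
      · exact hA
      · exact hB
    · rcases h x with h | h
      · exact ⟨0, h⟩
      · exact ⟨1, h⟩
  omega

/-- The vertex in position `i` is joined to the `k` vertices that follow it. -/
def ReachesRight (G : SimpleGraph V) (v : ZMod n ≃ V) (i : ZMod n) (k : ℕ) : Prop :=
  ∀ m ≤ k, v (i + m) ∈ G.closedNeighborSet (v i)

/-- The vertex in position `i` is joined to the `k` vertices that precede it. -/
def ReachesLeft (G : SimpleGraph V) (v : ZMod n ≃ V) (i : ZMod n) (k : ℕ) : Prop :=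
  ∀ m ≤ k, v (i - m) ∈ G.closedNeighborSet (v i)

theorem ReachesRight.mem {i : ZMod n} {k : ℕ} (h : G.ReachesRight v i k) {j : ZMod n} (m : ℕ)
    (hm : m ≤ k) (hj : j = i + m) : v j ∈ G.closedNeighborSet (v i) :=
  hj ▸ h m hm

theorem ReachesLeft.mem {i : ZMod n} {k : ℕ} (h : G.ReachesLeft v i k) {j : ZMod n} (m : ℕ)
    (hm : m ≤ k) (hj : j = i - m) : v j ∈ G.closedNeighborSet (v i) :=
  hj ▸ h m hm

theorem ReachesRight.mono {i : ZMod n} {k l : ℕ} (h : G.ReachesRight v i k) (hl : l ≤ k) :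
    G.ReachesRight v i l := fun m hm => h m (hm.trans hl)

theorem reachesRight_zero (i : ZMod n) : G.ReachesRight v i 0 := fun m hm => by
  rw [Nat.le_zero.1 hm]
  simp [mem_closedNeighborSet]

theorem reachesLeft_zero (i : ZMod n) : G.ReachesLeft v i 0 := fun m hm => by
  rw [Nat.le_zero.1 hm]
  simp [mem_closedNeighborSet]

/-- The neighbour has an offset t ≡ k mod n in the interval of the round ordering. For 0 < k < n, t
≥ 0 forces t ≥ k and t < 0 forces -t ≥ n - k; the interval contains all offsets between 0 and t. -/
theorem IsRoundOrdering.reaches_or (hv : G.IsRoundOrdering v) {i : ZMod n} {k : ℕ} (hk : k ≤ n)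
    (h : v (i + k) ∈ G.closedNeighborSet (v i)) :
    G.ReachesRight v i k ∨ G.ReachesLeft v i (n - k) := by
  obtain ⟨l, r, hN⟩ := hv i
  rw [hN] at h
  obtain ⟨t, hlt, htr, ht⟩ := h
  have hcast : ((k : ℤ) : ZMod n) = (t : ZMod n) := by
    simpa using v.injective ht
  obtain ⟨q, hq⟩ := (ZMod.intCast_eq_intCast_iff_dvd_sub _ _ _).1 hcast
  rcases hk.lt_or_eq with hkn | rfl
  · rcases Nat.eq_zero_or_pos k with rfl | hk0
    · exact Or.inl (reachesRight_zero i)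
    rcases le_or_gt 0 t with h0 | h0
    · left
      intro m hm
      rw [hN]
      have hkt : (k : ℤ) ≤ t := by
        have : 0 ≤ q := by
          by_contra hneg
          have : (n : ℤ) * q ≤ n * (-1) := by
            apply mul_le_mul_of_nonneg_left <;> omega
          omega
        have : 0 ≤ (n : ℤ) * q := by positivity
        omega
      exact ⟨m, by omega, by omega, by simp⟩
    · right
      intro m hm
      rw [hN]
      have hkt : (n : ℤ) - k ≤ -t := by
        have : q ≤ -1 := by
          by_contra hneg
          have : 0 ≤ (n : ℤ) * q := mul_nonneg (by omega) (by omega)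
          omega
        have : (n : ℤ) * q ≤ n * (-1) := by
          apply mul_le_mul_of_nonneg_left <;> omega
        omega
      exact ⟨-m, by omega, by omega, by push_cast; rw [sub_eq_add_neg]⟩
  · right
    rw [Nat.sub_self]
    exact reachesLeft_zero i

theorem isClique_of_index (i : ZMod n) (P : ℕ → Prop)
    (h : ∀ m m', P m → P m' → m < m' → v (i + m) ∈ G.closedNeighborSet (v (i + m'))) :
    G.IsClique {x | ∃ m, P m ∧ x = v (i + m)} := by
  rintro _ ⟨m, hm, rfl⟩ _ ⟨m', hm', rfl⟩ hne
  rcases lt_trichotomy m m' with hlt | rfl | hlt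
  · rcases mem_closedNeighborSet.1 (h m m' hm hm' hlt) with h1 | h1
    · exact absurd h1 hne
    · exact h1.symm
  · exact absurd rfl hne
  · rcases mem_closedNeighborSet.1 (h m' m hm' hm hlt) with h1 | h1
    · exact absurd h1.symm hne
    · exact h1

theorem exists_index [NeZero n] (v : ZMod n ≃ V) (i : ZMod n) (x : V) :
    ∃ m < n, x = v (i + (m : ℕ)) := by
  refine ⟨(v.symm x - i).val, ZMod.val_lt _, ?_⟩
  rw [ZMod.natCast_val, ZMod.cast_id', id_eq, add_sub_cancel, Equiv.apply_symm_apply]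

/-- Otherwise the arcs from i to i + k and back cover the circle. Each vertex is adjacent to the
start of its arc, so it reaches back to that start or forward round to it. Joining the backward
vertices of one arc to the forward ones of the other gives two covering cliques. -/
theorem IsRoundOrdering.not_reachesRight_both [NeZero n] (hv : G.IsRoundOrdering v)
    (hcc : 3 ≤ G.cliqueCoveringNumber) {i : ZMod n} {k : ℕ} (hkn : k < n)
    (h1 : G.ReachesRight v i k) : ¬ G.ReachesRight v (i + k) (n - k) := by
  intro h2
  have hB : ∀ b, 0 < b → b < k →
      G.ReachesRight v (i + b) (n - b) ∨ G.ReachesLeft v (i + b) b := by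
    intro b hb hbk
    have := hv.reaches_or (i := i + b) (k := n - b) (by omega) (by
      rw [mem_closedNeighborSet_comm, Nat.cast_sub (by omega)]
      simpa using h1 b hbk.le)
    rwa [Nat.sub_sub_self (by omega)] at this
  have hC : ∀ c, k ≤ c → c < n →
      G.ReachesRight v (i + c) (n - c + k) ∨ G.ReachesLeft v (i + c) (c - k) := by
    intro c hkc hcn
    have := hv.reaches_or (i := i + c) (k := n - c + k) (by omega) (by
      rw [mem_closedNeighborSet_comm, Nat.cast_add, Nat.cast_sub (by omega)]
      have : (v (i + ↑c + (↑n - ↑c + ↑k))) = v (i + k) := by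
        congr 1
        rw [ZMod.natCast_self]
        ring
      rw [this]
      refine h2.mem (c - k) (by omega) ?_
      rw [Nat.cast_sub hkc]
      ring)
    rwa [show n - (n - c + k) = c - k by omega] at this
  refine not_cover_of_three_le hcc
    (isClique_of_index (G := G) (v := v) i (fun m => (m < k ∧ G.ReachesLeft v (i + m) m) ∨
      (k ≤ m ∧ m < n ∧ G.ReachesRight v (i + m) (n - m + k))) ?_)
    (isClique_of_index (G := G) (v := v) i (fun m => (m < k ∧ G.ReachesRight v (i + m) (n - m)) ∨
      (k ≤ m ∧ m < n ∧ G.ReachesLeft v (i + m) (m - k))) ?_) ?_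
  · rintro m m' (⟨hm, h⟩ | ⟨hm, hmn, h⟩) (⟨hm', h'⟩ | ⟨hm', hmn', h'⟩) hlt
    · exact h'.mem (m' - m) (by omega) (by rw [Nat.cast_sub hlt.le]; ring)
    · refine h'.mem (n - m' + m) (by omega) ?_
      rw [Nat.cast_add, Nat.cast_sub hmn'.le, ZMod.natCast_self]
      ring
    · omega
    · rw [mem_closedNeighborSet_comm]
      exact h.mem (m' - m) (by omega) (by rw [Nat.cast_sub hlt.le]; ring)
  · rintro m m' (⟨hm, h⟩ | ⟨hm, hmn, h⟩) (⟨hm', h'⟩ | ⟨hm', hmn', h'⟩) hlt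
    · rw [mem_closedNeighborSet_comm]
      exact h.mem (m' - m) (by omega) (by rw [Nat.cast_sub hlt.le]; ring)
    · rw [mem_closedNeighborSet_comm]
      exact h.mem (m' - m) (by omega) (by rw [Nat.cast_sub hlt.le]; ring)
    · omega
    · exact h'.mem (m' - m) (by omega) (by rw [Nat.cast_sub hlt.le]; ring)
  · intro x
    obtain ⟨m, hm, rfl⟩ := exists_index v i x
    rcases lt_or_ge m k with hmk | hmk
    · rcases Nat.eq_zero_or_pos m with rfl | hm0
      · exact Or.inl ⟨0, Or.inl ⟨hmk, reachesLeft_zero _⟩, rfl⟩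
      · rcases hB m hm0 hmk with h | h
        · exact Or.inr ⟨m, Or.inl ⟨hmk, h⟩, rfl⟩
        · exact Or.inl ⟨m, Or.inl ⟨hmk, h⟩, rfl⟩
    · rcases hC m hmk hm with h | h
      · exact Or.inl ⟨m, Or.inr ⟨hmk, hm, h⟩, rfl⟩
      · exact Or.inr ⟨m, Or.inr ⟨hmk, hm, h⟩, rfl⟩

theorem IsRoundOrdering.neg (hv : G.IsRoundOrdering v) :
    G.IsRoundOrdering ((Equiv.neg (ZMod n)).trans v) := by
  intro i
  obtain ⟨l, r, h⟩ := hv (-i)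
  refine ⟨r, l, ?_⟩
  simp only [Equiv.trans_apply, Equiv.neg_apply]
  rw [h]
  ext x
  constructor
  · rintro ⟨k, h1, h2, rfl⟩
    exact ⟨-k, by omega, by omega, by push_cast; congr 1; ring⟩
  · rintro ⟨k, h1, h2, rfl⟩
    exact ⟨-k, by omega, by omega, by push_cast; congr 1; ring⟩

theorem reachesRight_neg {i : ZMod n} {k : ℕ} :
    G.ReachesRight ((Equiv.neg (ZMod n)).trans v) (-i) k ↔ G.ReachesLeft v i k := by
  simp only [ReachesRight, ReachesLeft, Equiv.trans_apply, Equiv.neg_apply, neg_neg, neg_add,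
    sub_eq_add_neg]

theorem IsRoundOrdering.not_reachesLeft_both [NeZero n] (hv : G.IsRoundOrdering v)
    (hcc : 3 ≤ G.cliqueCoveringNumber) {i : ZMod n} {k : ℕ} (hk : 0 < k) (hkn : k < n)
    (h1 : G.ReachesLeft v i (n - k)) : ¬ G.ReachesLeft v (i + k) k := by
  intro h2
  rw [← reachesRight_neg] at h1 h2
  refine hv.neg.not_reachesRight_both hcc (by omega) h1 ?_
  rw [Nat.sub_sub_self hkn.le, Nat.cast_sub hkn.le, ZMod.natCast_self]
  rwa [show -i + (0 - (k : ZMod n)) = -(i + k) by ring]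

theorem IsRoundOrdering.reachesRight_or [NeZero n] (hv : G.IsRoundOrdering v)
    (hcc : 3 ≤ G.cliqueCoveringNumber) {i : ZMod n} {k : ℕ} (hk : 0 < k) (hkn : k < n)
    (h : v (i + k) ∈ G.closedNeighborSet (v i)) :
    G.ReachesRight v i k ∨ G.ReachesRight v (i + k) (n - k) := by
  rcases hv.reaches_or hkn.le h with h1 | h1
  · exact Or.inl h1
  have := hv.reaches_or (i := i + k) (k := n - k) (by omega) (by
    rw [mem_closedNeighborSet_comm, Nat.cast_sub hkn.le]
    simpa using h)
  rw [Nat.sub_sub_self hkn.le] at this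
  exact Or.inr (this.resolve_right (hv.not_reachesLeft_both hcc hk hkn h1))

theorem IsRoundOrdering.reachesLeft_of_reachesRight [NeZero n] (hv : G.IsRoundOrdering v)
    (hcc : 3 ≤ G.cliqueCoveringNumber) {i : ZMod n} {k : ℕ} (hkn : k < n)
    (h : G.ReachesRight v i k) : G.ReachesLeft v (i + k) k := by
  have := hv.reaches_or (i := i + k) (k := n - k) (by omega) (by
    rw [mem_closedNeighborSet_comm, Nat.cast_sub hkn.le]
    simpa using h k le_rfl)
  rw [Nat.sub_sub_self hkn.le] at this
  exact this.resolve_left (hv.not_reachesRight_both hcc hkn h)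

theorem IsRoundOrdering.mem_of_reachesRight [NeZero n] (hv : G.IsRoundOrdering v)
    (hcc : 3 ≤ G.cliqueCoveringNumber) {i : ZMod n} {k m m' : ℕ} (hkn : k < n)
    (h : G.ReachesRight v i k) (hm : m ≤ m') (hm' : m' ≤ k) :
    v (i + m) ∈ G.closedNeighborSet (v (i + m')) :=
  (hv.reachesLeft_of_reachesRight hcc (by omega) (h.mono hm')).mem (m' - m) (by omega)
    (by rw [Nat.cast_sub hm]; ring)

theorem IsRoundOrdering.isClique_of_reachesRight [NeZero n] (hv : G.IsRoundOrdering v)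
    (hcc : 3 ≤ G.cliqueCoveringNumber) {i : ZMod n} {k : ℕ} (hkn : k < n)
    (h : G.ReachesRight v i k) : G.IsClique {x | ∃ m, m ≤ k ∧ x = v (i + (m : ℕ))} :=
  isClique_of_index i (fun m => m ≤ k) fun _ _ _ hm' hlt =>
    hv.mem_of_reachesRight hcc hkn h hlt.le hm'

theorem IsRoundOrdering.reachesRight_of_le [NeZero n] (hv : G.IsRoundOrdering v)
    (hcc : 3 ≤ G.cliqueCoveringNumber) {i : ZMod n} {k a : ℕ} (hkn : k < n)
    (h : G.ReachesRight v i k) (ha : a ≤ k) : G.ReachesRight v (i + a) (k - a) := by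
  intro m hm
  rw [mem_closedNeighborSet_comm]
  have := hv.mem_of_reachesRight hcc hkn h (m := a) (m' := a + m) (by omega) (by omega)
  rwa [Nat.cast_add, ← add_assoc] at this

/-- Reached arcs are cliques; two consecutive ones, with k + 1 and l + 1 positions, cannot cover the
circle. -/
theorem IsRoundOrdering.add_add_two_lt [NeZero n] (hv : G.IsRoundOrdering v)
    (hcc : 3 ≤ G.cliqueCoveringNumber) {i : ZMod n} {k l : ℕ}
    (hk : G.ReachesRight v i k) (hl : G.ReachesRight v (i + k + 1) l) : k + l + 2 < n := by
  have hn : 0 < n := Nat.pos_of_ne_zero (NeZero.ne n)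
  by_contra hcon
  rcases Nat.lt_or_ge k n with hkn | hkn
  · refine not_cover_of_three_le hcc (hv.isClique_of_reachesRight hcc hkn hk)
      (hv.isClique_of_reachesRight hcc (k := min l (n - 1)) (by omega)
        (hl.mono (min_le_left _ _))) fun x => ?_
    obtain ⟨m, hm, rfl⟩ := exists_index v i x
    rcases le_or_gt m k with h | h
    · exact Or.inl ⟨m, h, rfl⟩
    · refine Or.inr ⟨m - (k + 1), by omega, ?_⟩
      rw [Nat.cast_sub h]
      push_cast
      congr 1
      ring
  · refine not_cover_of_three_le hcc (hv.isClique_of_reachesRight hcc (k := n - 1) (by omega)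
      (hk.mono (by omega))) (B := ∅) (by simp) fun x => ?_
    obtain ⟨m, hm, rfl⟩ := exists_index v i x
    exact Or.inl ⟨m, by omega, rfl⟩

theorem IsRoundOrdering.add_two_lt [NeZero n] (hv : G.IsRoundOrdering v)
    (hcc : 3 ≤ G.cliqueCoveringNumber) {i : ZMod n} {k : ℕ}
    (hk : G.ReachesRight v i k) : k + 2 < n :=
  hv.add_add_two_lt hcc hk (reachesRight_zero _)

end SimpleGraph
-- Cutting the round ordering at the pseudo-cutvertex
namespace SimpleGraph
variable {V : Type*}

variable {G : SimpleGraph V} {n : ℕ} {v : ZMod n ≃ V}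

open Classical in
/-- In the round ordering cut open at position `p`, the last vertex reached from the right of the
vertex `a`. -/
noncomputable def rightEnd (G : SimpleGraph V) (v : ZMod n ≃ V) (p : ZMod n) (a : ℕ) : ℕ :=
  if a < n then Nat.findGreatest (fun b => a ≤ b ∧ G.ReachesRight v (p + a) (b - a)) n else a

/-- In the round ordering cut open at position `p`, the first vertex that reaches the vertex `b`
on its right. -/
noncomputable def leftEnd (G : SimpleGraph V) (v : ZMod n ≃ V) (p : ZMod n) (b : ℕ) : ℕ :=
  sInf {a | b ≤ rightEnd G v p a}

/-- The vertex in position `p` is the only pseudo-cutvertex of the round ordering `v`. -/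
structure IsOnlyPseudoCut (G : SimpleGraph V) (v : ZMod n ≃ V) (p : ZMod n) : Prop where
  round : G.IsRoundOrdering v
  three_le : 3 ≤ G.cliqueCoveringNumber
  not_adj : ¬ G.Adj (v (p - 1)) (v (p + 1))
  adj : ∀ i, i ≠ p → G.Adj (v (i - 1)) (v (i + 1))

variable {p : ZMod n}

theorem rightEnd_le {a : ℕ} (ha : a ≤ n) : rightEnd G v p a ≤ n := by
  classical
  rw [rightEnd]
  split_ifs
  · exact Nat.findGreatest_le _
  · exact ha

theorem reachesRight_rightEnd {a : ℕ} (ha : a < n) :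
    G.ReachesRight v (p + a) (rightEnd G v p a - a) := by
  classical
  rw [rightEnd, if_pos ha]
  exact (Nat.findGreatest_spec (P := fun b => a ≤ b ∧ G.ReachesRight v (p + a) (b - a)) ha.le
    ⟨le_rfl, by rw [Nat.sub_self]; exact reachesRight_zero _⟩).2

theorem le_rightEnd_self (a : ℕ) : a ≤ rightEnd G v p a := by
  classical
  rw [rightEnd]
  split_ifs with ha
  · exact Nat.le_findGreatest ha.le ⟨le_rfl, by rw [Nat.sub_self]; exact reachesRight_zero _⟩
  · exact le_rfl

theorem le_rightEnd_iff {a b : ℕ} (ha : a < n) (hab : a ≤ b) (hb : b ≤ n) :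
    b ≤ rightEnd G v p a ↔ G.ReachesRight v (p + a) (b - a) := by
  classical
  constructor
  · intro h
    exact (reachesRight_rightEnd ha).mono (by omega)
  · intro h
    rw [rightEnd, if_pos ha]
    exact Nat.le_findGreatest hb ⟨hab, h⟩

theorem index_injective {a b : ℕ} (ha : a < n) (hb : b < n)
    (hab : v (p + a) = v (p + b)) : a = b := by
  have h1 := add_left_cancel (v.injective hab)
  rw [ZMod.natCast_eq_natCast_iff', Nat.mod_eq_of_lt ha, Nat.mod_eq_of_lt hb] at h1
  exact h1

namespace IsOnlyPseudoCut

variable [NeZero n]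

theorem two_lt (h : G.IsOnlyPseudoCut v p) : 2 < n := by
  simpa using h.round.add_two_lt h.three_le (reachesRight_zero 0)

theorem not_reachesRight_two (h : G.IsOnlyPseudoCut v p) : ¬ G.ReachesRight v (p - 1) 2 := by
  intro h2
  have h3 := h2.mem (j := p + 1) 2 le_rfl (by push_cast; ring)
  rcases mem_closedNeighborSet.1 h3 with h4 | h4
  · have h5 : (p + 1) - (p - 1) = 0 := sub_eq_zero.2 (v.injective h4)
    have h6 : ((2 : ℕ) : ZMod n) = 0 := by
      rw [← h5]; push_cast; ring
    rw [ZMod.natCast_eq_zero_iff] at h6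
    exact absurd (Nat.le_of_dvd two_pos h6) (not_le.2 h.two_lt)
  · exact h.not_adj h4

theorem reachesRight_two (h : G.IsOnlyPseudoCut v p) {i : ZMod n} (hi : i + 1 ≠ p) :
    G.ReachesRight v i 2 := by
  have hn := h.two_lt
  have h1 := h.adj (i + 1) hi
  have h2 : i + 1 + 1 = i + (2 : ℕ) := by push_cast; ring
  rw [add_sub_cancel_right, h2] at h1
  -- Otherwise i + 2 would reach round to i, an arc of n - 2 steps, which is too long.
  refine (h.round.reachesRight_or h.three_le two_pos hn
    (mem_closedNeighborSet.2 (Or.inr h1))).resolve_right fun h3 => ?_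
  have := h.round.add_two_lt h.three_le h3
  omega

theorem reachesRight_one (h : G.IsOnlyPseudoCut v p) (i : ZMod n) : G.ReachesRight v i 1 := by
  have hn := h.two_lt
  have h1 : i - 1 + 1 ≠ p ∨ i + 1 ≠ p := by
    by_contra! hcon
    have h6 : ((1 : ℕ) : ZMod n) = 0 := by
      rw [← sub_self p]
      nth_rewrite 1 [← hcon.2]
      rw [← hcon.1]; push_cast; ring
    rw [ZMod.natCast_eq_zero_iff] at h6
    have := Nat.le_of_dvd one_pos h6
    omega
  rcases h1 with h1 | h1
  · have := h.round.reachesRight_of_le h.three_le hn (h.reachesRight_two h1) one_le_two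
    simpa using this
  · exact (h.reachesRight_two h1).mono one_le_two

theorem monotone_rightEnd (h : G.IsOnlyPseudoCut v p) : Monotone (rightEnd G v p) := by
  intro a b hab
  rcases lt_or_ge b n with hb | hb
  · have ha : a < n := by omega
    rcases le_or_gt (rightEnd G v p a) b with hle | hlt
    · exact hle.trans (le_rightEnd_self b)
    · have h1 := reachesRight_rightEnd (G := G) (v := v) (p := p) ha
      have h2 := h.round.add_two_lt h.three_le h1
      have h3 := h.round.reachesRight_of_le h.three_le (by omega) h1 (a := b - a) (by omega)
      rw [le_rightEnd_iff hb hlt.le (rightEnd_le ha.le)]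
      rw [Nat.cast_sub hab] at h3
      convert h3 using 1
      · ring
      · omega
  · rcases lt_or_ge a n with ha | ha
    · exact (rightEnd_le ha.le).trans (hb.trans (le_rightEnd_self b))
    -- The default value a beyond n keeps the map monotone on all of ℕ.
    · simp only [rightEnd, not_lt.2 ha, not_lt.2 hb, if_false, hab]

theorem gc (h : G.IsOnlyPseudoCut v p) :
    GaloisConnection (leftEnd G v p) (rightEnd G v p) := by
  intro b a
  constructor
  · intro hle
    have : leftEnd G v p b ∈ {a | b ≤ rightEnd G v p a} := Nat.sInf_mem ⟨b, le_rightEnd_self b⟩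
    exact le_trans this (h.monotone_rightEnd hle)
  · intro hle
    exact Nat.sInf_le hle

theorem adj_of_le_rightEnd (h : G.IsOnlyPseudoCut v p) {a b : ℕ} (hab : a < b) (hb : b ≤ n)
    (hr : b ≤ rightEnd G v p a) : G.Adj (v (p + a)) (v (p + b)) := by
  rw [le_rightEnd_iff (by omega) hab.le hb] at hr
  have hlt := h.round.add_two_lt h.three_le hr
  refine (mem_closedNeighborSet.1 (hr.mem (j := p + b) (b - a) le_rfl
    (by rw [Nat.cast_sub hab.le]; ring))).resolve_left fun heq => ?_
  have h1 := add_left_cancel (v.injective heq)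
  have h6 : ((b - a : ℕ) : ZMod n) = 0 := by rw [Nat.cast_sub hab.le, h1, sub_self]
  rw [ZMod.natCast_eq_zero_iff] at h6
  have := Nat.le_of_dvd (by omega) h6
  omega

/-- An edge wrapping round the cut must stop at p: going further, its arc would contain p - 1 and p
+ 1 and make them adjacent. -/
theorem adj_iff (h : G.IsOnlyPseudoCut v p) {a b : ℕ} (hab : a < b) (hb : b < n) :
    G.Adj (v (p + a)) (v (p + b)) ↔
      b ≤ rightEnd G v p a ∨ (a = 0 ∧ n ≤ rightEnd G v p b) := by
  have hcast : p + (b : ZMod n) = p + a + (b - a : ℕ) := by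
    rw [Nat.cast_sub hab.le]; ring
  constructor
  · intro hadj
    rw [hcast] at hadj
    rcases h.round.reachesRight_or h.three_le (by omega) (by omega)
      (mem_closedNeighborSet.2 (Or.inr hadj)) with h1 | h1
    · exact Or.inl ((le_rightEnd_iff (by omega) hab.le hb.le).2 h1)
    · rw [← hcast] at h1
      refine Or.inr ⟨?_, (le_rightEnd_iff hb hb.le le_rfl).2 (h1.mono (by omega))⟩
      by_contra ha
      refine h.not_reachesRight_two ?_
      have h2 := h.round.reachesRight_of_le h.three_le (by omega) h1 (a := n - 1 - b) (by omega)
      have h3 : p + (b : ZMod n) + (n - 1 - b : ℕ) = p - 1 := by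
        rw [Nat.cast_sub (by omega), Nat.cast_sub (by omega), ZMod.natCast_self]
        push_cast
        ring
      rw [h3] at h2
      exact h2.mono (by omega)
  · rintro (h1 | ⟨rfl, h1⟩)
    · exact h.adj_of_le_rightEnd hab hb.le h1
    · have := h.adj_of_le_rightEnd hb le_rfl h1
      rw [ZMod.natCast_self] at this
      simpa using this.symm

theorem mem_closedNeighborSet_iff (h : G.IsOnlyPseudoCut v p) {a b : ℕ} (ha0 : 0 < a)
    (ha : a < n) (hb : b < n) : v (p + b) ∈ G.closedNeighborSet (v (p + a)) ↔
      (leftEnd G v p a ≤ b ∧ b ≤ rightEnd G v p a) ∨ (b = 0 ∧ n ≤ rightEnd G v p a) := by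
  rw [h.gc, mem_closedNeighborSet]
  have hma := le_rightEnd_self (G := G) (v := v) (p := p) a
  have hmb := le_rightEnd_self (G := G) (v := v) (p := p) b
  rcases lt_trichotomy a b with hab | rfl | hab
  · rw [h.adj_iff hab hb]
    constructor
    · rintro (h1 | h1 | h1)
      · have := index_injective hb ha h1; omega
      · exact Or.inl ⟨by omega, h1⟩
      · omega
    · rintro (h1 | h1)
      · exact Or.inr (Or.inl h1.2)
      · omega
  · simp [hma]
  · rw [G.adj_comm, h.adj_iff hab ha]
    constructor
    · rintro (h1 | h1 | h1)
      · have := index_injective hb ha h1; omega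
      · exact Or.inl ⟨h1, by omega⟩
      · exact Or.inr h1
    · rintro (h1 | h1)
      · exact Or.inr (Or.inl h1.1)
      · exact Or.inr (Or.inr h1)

theorem cutOrder (h : G.IsOnlyPseudoCut v p) (hred : G.IsReduced) :
    CutOrder n (rightEnd G v p) (leftEnd G v p) where
  mono := h.monotone_rightEnd
  gc := h.gc
  le_last _ hx := rightEnd_le hx
  add_two_le x hx := by
    rw [le_rightEnd_iff (by omega) (by omega) hx, Nat.add_sub_cancel_left]
    refine h.reachesRight_two fun heq => ?_
    have h6 : ((x + 1 : ℕ) : ZMod n) = 0 := by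
      push_cast
      rwa [add_assoc, add_eq_left] at heq
    rw [ZMod.natCast_eq_zero_iff] at h6
    have := Nat.le_of_dvd (by omega) h6
    omega
  le_right := le_rightEnd_self
  lt_right x hx := by
    refine Nat.succ_le_iff.1 ?_
    rw [le_rightEnd_iff hx (Nat.le_succ x) hx, Nat.succ_eq_add_one, Nat.add_sub_cancel_left]
    exact h.reachesRight_one _
  not_twin x hx0 hx := by
    by_contra! hcon
    have hR : rightEnd G v p (x + 1) = rightEnd G v p x :=
      le_antisymm hcon.1 (h.monotone_rightEnd (by omega))
    have hL : leftEnd G v p (x + 1) = leftEnd G v p x :=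
      le_antisymm hcon.2 (h.gc.monotone_l (by omega))
    have heq : v (p + x) = v (p + (x + 1 : ℕ)) := by
      refine hred _ _ (Set.ext fun y => ?_)
      obtain ⟨b, hb, rfl⟩ := exists_index v p y
      rw [h.mem_closedNeighborSet_iff hx0 (by omega) hb,
        h.mem_closedNeighborSet_iff (by omega) hx hb, hR, hL]
    have := index_injective (by omega) hx heq
    omega

theorem rightEnd_zero_add_one (h : G.IsOnlyPseudoCut v p) :
    rightEnd G v p (rightEnd G v p 0 + 1) + 1 < n := by
  have hn := h.two_lt
  have h1 := reachesRight_rightEnd (G := G) (v := v) (p := p) (a := 0) (by omega)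
  have h2 := h.round.add_two_lt h.three_le h1
  have h3 := reachesRight_rightEnd (G := G) (v := v) (p := p) (a := rightEnd G v p 0 + 1)
    (by omega)
  rw [Nat.sub_zero, Nat.cast_zero, add_zero] at h1
  rw [Nat.cast_add, Nat.cast_one, ← add_assoc] at h3
  have := h.round.add_add_two_lt h.three_le h1 h3
  omega

theorem rightEnd_one_add_one (h : G.IsOnlyPseudoCut v p) :
    rightEnd G v p (rightEnd G v p 1 + 1) < n := by
  have hn := h.two_lt
  have h0 := le_rightEnd_self (G := G) (v := v) (p := p) 1
  have h1 := reachesRight_rightEnd (G := G) (v := v) (p := p) (a := 1) (by omega)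
  have h2 := h.round.add_two_lt h.three_le h1
  have h3 := reachesRight_rightEnd (G := G) (v := v) (p := p) (a := rightEnd G v p 1 + 1)
    (by omega)
  have h4 : p + ((rightEnd G v p 1 + 1 : ℕ) : ZMod n) =
      p + (1 : ℕ) + (rightEnd G v p 1 - 1 : ℕ) + 1 := by
    rw [Nat.cast_sub h0]; push_cast; ring
  rw [h4] at h3
  have := h.round.add_add_two_lt h.three_le h1 h3
  omega

end IsOnlyPseudoCut

/-! ### Transfer of the edge colouring -/

open Classical in
/-- The colour of the edge `xy` as a truth value, `false` if `xy` is not an edge. -/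
noncomputable def edgeColour (φ : G.EdgeLabeling (Fin 2)) (x y : V) : Bool :=
  if h : G.Adj x y then decide (φ.get x y h = 0) else false

theorem edgeColour_comm (φ : G.EdgeLabeling (Fin 2)) (x y : V) :
    edgeColour φ x y = edgeColour φ y x := by
  by_cases h : G.Adj x y
  · simp only [edgeColour, h, h.symm, dif_pos]
    rw [EdgeLabeling.get_comm]
  · simp only [edgeColour, h, G.adj_comm y x, dif_neg, not_false_eq_true]

theorem IsLocallyCompleteColouring.edgeColour_ne {φ : G.EdgeLabeling (Fin 2)}
    (hφ : G.IsLocallyCompleteColouring φ) {x y z : V} (hxy : G.Adj x y) (hyz : G.Adj y z)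
    (hne : x ≠ z) (hxz : ¬ G.Adj x z) : edgeColour φ x y ≠ edgeColour φ y z := by
  intro heq
  rw [edgeColour_comm] at heq
  simp only [edgeColour, hxy.symm, hyz, dif_pos, decide_eq_decide] at heq
  have h1 : φ.get y x hxy.symm = φ.get y z hyz := by omega
  exact hxz (hφ y (φ.get y z hyz) ⟨hxy.symm, h1⟩ ⟨hyz, rfl⟩ hne)

/-- Since 0 and n are one vertex, the ends of a path may also coincide or be adjacent through the
cut; the side conditions exclude this. -/
theorem IsOnlyPseudoCut.isLocallyComplete [NeZero n] (h : G.IsOnlyPseudoCut v p)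
    {φ : G.EdgeLabeling (Fin 2)} (hφ : G.IsLocallyCompleteColouring φ) :
    CutOrder.IsLocallyComplete n (rightEnd G v p)
      fun i j => edgeColour φ (v (p + (i : ℕ))) (v (p + (j : ℕ))) where
  ne i j k hij hjk hk hj hk' hik h0 hn := by
    have hiRi := le_rightEnd_self (G := G) (v := v) (p := p) i
    have hcast : v (p + (n : ZMod n)) = v (p + (0 : ℕ)) := by simp
    refine hφ.edgeColour_ne (h.adj_of_le_rightEnd hij (by omega) hj)
      (h.adj_of_le_rightEnd hjk hk hk') (fun heq => ?_) fun hadj => ?_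
    · rcases hk.lt_or_eq with hkn | rfl
      · have := index_injective (by omega) hkn heq
        omega
      · rw [hcast] at heq
        have := index_injective (by omega) (by omega) heq
        exact hn ⟨rfl, by omega⟩
    · rcases hk.lt_or_eq with hkn | rfl
      · rw [h.adj_iff (by omega) hkn] at hadj
        rcases hadj with h1 | h1
        · omega
        · exact h0 h1
      · rcases Nat.eq_zero_or_pos i with rfl | hi
        · exact hn ⟨rfl, by omega⟩
        · rw [hcast, G.adj_comm, h.adj_iff hi (by omega)] at hadj
          rcases hadj with h1 | h1
          · exact hn ⟨rfl, h1⟩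
          · omega
  ne_end i k hi hin hk hkR hik := by
    have hcast : v (p + (n : ZMod n)) = v (p + (0 : ℕ)) := by simp
    have hkRk := le_rightEnd_self (G := G) (v := v) (p := p) k
    have hadj1 := h.adj_of_le_rightEnd hi le_rfl hin
    have hadj2 := h.adj_of_le_rightEnd hk (by omega) hkR
    simp only [hcast] at hadj1 ⊢
    refine hφ.edgeColour_ne hadj1 hadj2 (fun heq => ?_) fun hadj => ?_
    · have := index_injective hi (by omega) heq
      omega
    · rw [G.adj_comm, h.adj_iff (by omega) hi] at hadj
      omega

end SimpleGraph

theorem mainTheorem8 {V : Type*} [Finite V] (G : SimpleGraph V)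
    (hreduced : G.IsReduced)
    (hpca : G.IsProperCircularArc)
    (hpig : ¬ G.IsProperInterval)
    (hcc : 3 ≤ G.cliqueCoveringNumber)
    {n : ℕ} (v : ZMod n ≃ V) (hv : G.IsRoundOrdering v)
    (hone : ∃! x : V, G.IsPseudoCutvertex v x) :
    ¬ G.IsLocallyCompleteTwoEdgeColourable := by
  rintro ⟨φ, hφ⟩
  -- `ZMod 0` is ℤ, which has no bijection with a finite V.
  have : NeZero n := ⟨by
    rintro rfl
    exact not_finite_iff_infinite.2 (Infinite.of_injective v v.injective : Infinite V) ‹_›⟩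
  obtain ⟨x, hx, huniq⟩ := hone
  have h : G.IsOnlyPseudoCut v (v.symm x) :=
    { round := hv
      three_le := hcc
      not_adj := hx
      adj := fun i hi => by
        by_contra hadj
        refine hi (v.symm_apply_eq.2 (huniq (v i) ?_).symm).symm
        simpa only [SimpleGraph.IsPseudoCutvertex, v.symm_apply_apply] using hadj }
  exact (h.cutOrder hreduced).not_isLocallyComplete h.rightEnd_zero_add_one
    h.rightEnd_one_add_one (h.isLocallyComplete hφ)
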